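/- For $t \ge 3$ let $S_t^+$ denote the graph on $t$ vertices obtained from the star with $t$ vertices (one center and $t-1$ leaves) by adding one edge joining two of the leaves. For graphs $G,H$ and an integer $k\ge 1$, let $gr_k(G:H)$ denote the minimum integer $m$ such that every coloring of the edges of the complete graph $K_m$ with (at most) $k$ colors contains a rainbow copy of $G$ (a copy whose edges have pairwise different colors) or a monochromatic copy of $H$. Let $k \ge 1$ and $t \ge 3$ be integers, and if $t = 3$ assume that $k$ is odd. Then $$ gr_k(K_3 : S_t^+) = \begin{cases} 2(t-1)\cdot 5^{\frac{k-2}{2}} + 1 & \text{if } k \text{ is even},\\ (t-1)\cdot 5^{\frac{k-1}{2}} + 1 & \text{if } k \text{ is odd}. \end{cases} $$ -/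

import Mathlib

namespace GallaiRamsey

/-- `C` is an edge-coloring of the complete graph on `V`. It contains a rainbow copy of `G` if some
copy of `G` has pairwise differently colored edges. -/
def HasRainbowCopy {V W K : Type*} (C : SimpleGraph.TopEdgeLabeling V K) (G : SimpleGraph W) :
    Prop :=
  ∃ f : SimpleGraph.Copy G (⊤ : SimpleGraph V),
    Function.Injective fun e : G.edgeSet => C (f.mapEdgeSet e)

/-- `C` contains a monochromatic copy of `H`: for some color `i`, the graph formed by the edges of
color `i` contains a (not necessarily induced) copy of `H`. -/
def HasMonochromaticCopy {V W K : Type*} (C : SimpleGraph.TopEdgeLabeling V K)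
    (H : SimpleGraph W) : Prop :=
  ∃ i : K, H.IsContained (C.labelGraph i)

/-- `m` is the Gallai-Ramsey number `gr_k(G : H)`: the minimum `m` such that every coloring of the
edges of the complete graph on `m` vertices with colors from a set of `k` colors contains a rainbow
copy of `G` or a monochromatic copy of `H`. -/
def IsGallaiRamseyNumber {U W : Type*} (k : ℕ) (G : SimpleGraph U) (H : SimpleGraph W) (m : ℕ) :
    Prop :=
  IsLeast {n : ℕ | ∀ C : SimpleGraph.TopEdgeLabeling (Fin n) (Fin k),
    HasRainbowCopy C G ∨ HasMonochromaticCopy C H} m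

/-- The graph `S_t^+`: the star with center `0` on the `t` vertices `0, …, t - 1`, together with an
edge joining the two leaves `1` and `2`. -/
def starPlus (t : ℕ) (ht : 3 ≤ t) : SimpleGraph (Fin t) :=
  SimpleGraph.starGraph (⟨0, by omega⟩ : Fin t) ⊔
    SimpleGraph.edge (⟨1, by omega⟩ : Fin t) ⟨2, by omega⟩

end GallaiRamsey

/-!
A Gallai coloring of order at least two is a blow-up of a reduced coloring with at most two colors,
both connected: contract the components of disconnected colors until none is left; three connected
colors are impossible, because deleting a vertex would keep all three connected, down to a single
edge.

If no color contains `S_t^+`, then no edge of color `i` joins two vertices of a color-`i`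
neighborhood of size at least `t - 1`. Let `F k` be the maximal order with `k` colors;
`F 1 = t - 1`, and degree counting gives `F 2 ≤ max (2 * (t - 1)) 5`. Let `k ≥ 3`, so that
`F (k - 2) ≥ t - 1`, and suppose that the reduced coloring has two colors. Every fiber lies in a
neighborhood of each of them, so a fiber of more than `F (k - 2)` vertices would avoid both.
Likewise, a neighborhood in one of them of more than `2 * F (k - 2)` vertices would avoid that
color, but it is covered by one fiber and one neighborhood in the other color. A fiber and its two
neighborhoods thus account for at most `5 * F (k - 2)` vertices. With one reduced color the bound
is `2 * F (k - 1)`. Substitution into an edge and into the two-colored pentagon shows that these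
bounds are attained.
-/

namespace GallaiRamsey

open SimpleGraph

universe u

variable {U V W K L : Type*}

theorem exists_labelGraph_adj (C : TopEdgeLabeling V K) {x y : V} (h : x ≠ y) :
    ∃ i, (C.labelGraph i).Adj x y :=
  ⟨C.get x y h, (TopEdgeLabeling.labelGraph_adj x y).2 ⟨h, rfl⟩⟩

theorem labelGraph_adj_unique {C : TopEdgeLabeling V K} {i j : K} {x y : V}
    (hi : (C.labelGraph i).Adj x y) (hj : (C.labelGraph j).Adj x y) : i = j := by
  obtain ⟨_, rfl⟩ := (TopEdgeLabeling.labelGraph_adj x y).1 hi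
  obtain ⟨_, rfl⟩ := (TopEdgeLabeling.labelGraph_adj x y).1 hj
  rfl

theorem labelGraph_adj_or_adj {C : TopEdgeLabeling V K} {i j : K}
    (h : ∀ k, k ≠ i → k ≠ j → C.labelGraph k = ⊥) {x y : V} (hxy : x ≠ y) :
    (C.labelGraph i).Adj x y ∨ (C.labelGraph j).Adj x y := by
  obtain ⟨k, hk⟩ := exists_labelGraph_adj C hxy
  by_contra! hne
  have hki : k ≠ i := by rintro rfl; exact hne.1 hk
  have hkj : k ≠ j := by rintro rfl; exact hne.2 hk
  simp [h k hki hkj] at hk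

theorem labelGraph_eq_compl {C : TopEdgeLabeling V K} {i j : K} (hij : i ≠ j)
    (h : ∀ k, k ≠ i → k ≠ j → C.labelGraph k = ⊥) : C.labelGraph j = (C.labelGraph i)ᶜ := by
  ext x y
  exact ⟨fun hj => ⟨hj.ne, fun hi => hij (labelGraph_adj_unique hi hj)⟩,
    fun ⟨hxy, hi⟩ => (labelGraph_adj_or_adj h hxy).resolve_left hi⟩

theorem labelGraph_pullback (C : TopEdgeLabeling V K) (f : W ↪ V) (i : K) :
    (C.pullback f).labelGraph i = (C.labelGraph i).comap f := by
  ext x y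
  simp only [TopEdgeLabeling.labelGraph_adj, comap_adj, f.injective.ne_iff]
  rfl

theorem free_labelGraph_pullback {C : TopEdgeLabeling V K} {i : K} {H : SimpleGraph U}
    (h : H.Free (C.labelGraph i)) (f : W ↪ V) : H.Free ((C.pullback f).labelGraph i) := by
  rw [labelGraph_pullback]
  exact fun hc => h (hc.trans ⟨(Embedding.comap f _).toCopy⟩)

theorem labelGraph_pullback_subtype_eq_bot_iff {C : TopEdgeLabeling V K} {i : K} {P : Set V} :
    (C.pullback (Function.Embedding.subtype (· ∈ P))).labelGraph i = ⊥ ↔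
      (C.labelGraph i).IsIndepSet P := by
  rw [labelGraph_pullback]
  simp only [eq_bot_iff_forall_not_adj, Subtype.forall, comap_adj, isIndepSet_iff, Set.Pairwise]
  exact ⟨fun h x hx y hy _ => h x hx y hy, fun h x hx y hy hxy => h hx hy hxy.ne hxy⟩

theorem labelGraph_compRight (C : TopEdgeLabeling V K) (e : K ≃ L) (i : L) :
    EdgeLabeling.labelGraph (C.compRight e) i = C.labelGraph (e.symm i) := by
  ext x y
  simp only [TopEdgeLabeling.labelGraph_adj, EdgeLabeling.compRight_get, e.eq_symm_apply]

/-- A Gallai coloring is an edge coloring of a complete graph without rainbow triangles. Colors are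
accessed through the graphs `C.labelGraph i` of the edges of color `i`. -/
def IsGallai (C : TopEdgeLabeling V K) : Prop :=
  ∀ ⦃x y z : V⦄ ⦃i j k : K⦄, (C.labelGraph i).Adj x y → (C.labelGraph j).Adj y z →
    (C.labelGraph k).Adj x z → i = j ∨ j = k ∨ i = k

theorem sym2_fin_three_cases :
    ∀ e : Sym2 (Fin 3), ¬ e.IsDiag → e = s(0, 1) ∨ e = s(1, 2) ∨ e = s(0, 2) := by
  decide

theorem hasRainbowCopy_triangle_iff (C : TopEdgeLabeling V K) :
    HasRainbowCopy C (⊤ : SimpleGraph (Fin 3)) ↔ ¬ IsGallai C := by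
  have label {x y : V} {i : K} (h : (C.labelGraph i).Adj x y) : C ⟨s(x, y), h.ne⟩ = i :=
    ((EdgeLabeling.labelGraph_adj x y).1 h).2
  constructor
  · rintro ⟨f, hf⟩ hC
    have adj {a b : Fin 3} (h : a ≠ b) :
        (C.labelGraph (C (f.mapEdgeSet ⟨s(a, b), h⟩))).Adj (f a) (f b) :=
      (EdgeLabeling.labelGraph_adj _ _).2 ⟨f.injective.ne h, rfl⟩
    rcases hC (adj (a := 0) (b := 1) (by decide)) (adj (a := 1) (b := 2) (by decide))
      (adj (a := 0) (b := 2) (by decide)) with h | h | h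
    all_goals exact absurd (congrArg Subtype.val (hf h)) (by decide)
  · intro hC
    simp only [IsGallai, not_forall, not_or] at hC
    obtain ⟨x, y, z, i, j, k, hxy, hyz, hxz, hij, hjk, hik⟩ := hC
    have hinj : Function.Injective ![x, y, z] := by
      simp [Function.Injective, Fin.forall_fin_succ, hxy.ne, hyz.ne, hxz.ne, hxy.ne', hyz.ne',
        hxz.ne']
    refine ⟨⟨⟨![x, y, z], fun hab => hinj.ne hab.ne⟩, hinj⟩, ?_⟩
    rintro ⟨e, he⟩ ⟨e', he'⟩ heq
    rcases sym2_fin_three_cases e (by simpa using he) with rfl | rfl | rfl <;>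
    rcases sym2_fin_three_cases e' (by simpa using he') with rfl | rfl | rfl
    · rfl
    · exact absurd ((label hxy).symm.trans (heq.trans (label hyz))) hij
    · exact absurd ((label hxy).symm.trans (heq.trans (label hxz))) hik
    · exact absurd ((label hxy).symm.trans (heq.symm.trans (label hyz))) hij
    · rfl
    · exact absurd ((label hyz).symm.trans (heq.trans (label hxz))) hjk
    · exact absurd ((label hxy).symm.trans (heq.symm.trans (label hxz))) hik
    · exact absurd ((label hyz).symm.trans (heq.symm.trans (label hxz))) hjk
    · rfl

theorem isGallai_of_card_le_two [Fintype K] (hK : Fintype.card K ≤ 2) (C : TopEdgeLabeling V K) :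
    IsGallai C := by
  intro x y z i j k _ _ _
  by_contra! h
  exact absurd (Fintype.two_lt_card_iff.2 ⟨i, j, k, h.1, h.2.2, h.2.1⟩) (by omega)

section Structure

variable {C : TopEdgeLabeling V K} {i j k : K}

theorem IsGallai.pullback (hC : IsGallai C) (f : W ↪ V) : IsGallai (C.pullback f) := by
  intro x y z i j k hxy hyz hxz
  rw [labelGraph_pullback] at hxy hyz hxz
  exact hC hxy hyz hxz

theorem IsGallai.adj_of_adj (hC : IsGallai C) {x y z : V} (hxy : (C.labelGraph i).Adj x y)
    (hxz : (C.labelGraph j).Adj x z) (hij : i ≠ j) (hne : y ≠ z)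
    (hyz : ¬ (C.labelGraph i).Adj y z) : (C.labelGraph j).Adj y z := by
  obtain ⟨k, hk⟩ := exists_labelGraph_adj C hne
  rcases hC hxy hk hxz with rfl | rfl | rfl
  · exact absurd hk hyz
  · exact hk
  · exact absurd rfl hij

theorem IsGallai.adj_of_reachable (hC : IsGallai C) {x y z : V}
    (hxy : (C.labelGraph i).Reachable x y) (hxz : ¬ (C.labelGraph i).Reachable x z)
    (h : (C.labelGraph j).Adj x z) : (C.labelGraph j).Adj y z := by
  obtain ⟨p⟩ := hxy
  induction p with
  | nil => exact h
  | @cons x a y hxa _ ih =>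
    have haz : ¬ (C.labelGraph i).Reachable a z := fun haz => hxz (hxa.reachable.trans haz)
    refine ih haz (hC.adj_of_adj hxa h ?_ ?_ fun h => haz h.reachable)
    · rintro rfl
      exact hxz h.reachable
    · rintro rfl
      exact haz .rfl

theorem IsGallai.adj_of_reachable_induce (hC : IsGallai C) {s : Set V} {x y z : s}
    (hxy : ((C.labelGraph i).induce s).Reachable x y)
    (hxz : ¬ ((C.labelGraph i).induce s).Reachable x z) (h : (C.labelGraph j).Adj x z) :
    (C.labelGraph j).Adj y z := by
  have := (hC.pullback (Function.Embedding.subtype (· ∈ s))).adj_of_reachable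
    (i := i) (j := j) (x := x) (y := y) (z := z)
  simp only [labelGraph_pullback] at this
  exact this hxy hxz h

theorem exists_reachable_induce_compl_singleton {G : SimpleGraph V} (hG : G.Preconnected) {v : V}
    (x : ({v}ᶜ : Set V)) : ∃ a, (G.induce {v}ᶜ).Reachable x a ∧ G.Adj a v := by
  obtain ⟨x, hx⟩ := x
  obtain ⟨p⟩ := hG x v
  clear hG
  induction p with
  | nil => exact absurd rfl hx
  | @cons x y v hxy _ ih =>
    by_cases hy : y = v
    · exact ⟨⟨x, hx⟩, .rfl, hy ▸ hxy⟩
    · obtain ⟨a, hya, hav⟩ := ih hy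
      exact ⟨a, (show (G.induce {v}ᶜ).Adj ⟨x, hx⟩ ⟨y, hy⟩ from hxy).reachable.trans hya, hav⟩

theorem IsGallai.adj_of_not_reachable_induce (hC : IsGallai C)
    (hi : (C.labelGraph i).Preconnected) {v : V} {x y : ({v}ᶜ : Set V)} (hij : i ≠ j)
    (hxv : (C.labelGraph j).Adj v x)
    (hxy : ¬ ((C.labelGraph i).induce {v}ᶜ).Reachable x y) : (C.labelGraph j).Adj y x := by
  obtain ⟨b, hyb, hbv⟩ := exists_reachable_induce_compl_singleton hi y
  have hxb : ¬ ((C.labelGraph i).induce {v}ᶜ).Reachable b x := fun h => hxy (hyb.trans h).symm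
  have hbx : (C.labelGraph j).Adj b x :=
    hC.adj_of_adj hbv.symm hxv hij (fun h => hxb (Subtype.ext h ▸ .rfl))
      fun h => hxb (show ((C.labelGraph i).induce {v}ᶜ).Adj b x from h).reachable
  exact hC.adj_of_reachable_induce hyb.symm hxb hbx

theorem IsGallai.preconnected_induce_compl_singleton (hC : IsGallai C) (hij : i ≠ j) (hik : i ≠ k)
    (hjk : j ≠ k) (hi : (C.labelGraph i).Preconnected) (hj : (C.labelGraph j).Preconnected)
    (hk : (C.labelGraph k).Preconnected) (v : V) :
    ((C.labelGraph i).induce {v}ᶜ).Preconnected := by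
  -- If color `i` falls apart, a `j`-neighbor `x` of `v` sends only color `j` to the other
  -- components, and a `k`-neighbor `z` only color `k`; these two color classes share an edge.
  by_contra hdisc
  obtain ⟨p, q, hpq⟩ : ∃ p q, ¬ ((C.labelGraph i).induce {v}ᶜ).Reachable p q := by
    simpa [Preconnected] using hdisc
  have : Nontrivial V := ⟨p, v, p.2⟩
  obtain ⟨x, hx⟩ := hj.exists_adj_of_nontrivial v
  obtain ⟨z, hz⟩ := hk.exists_adj_of_nontrivial v
  lift x to ({v}ᶜ : Set V) using hx.ne'
  lift z to ({v}ᶜ : Set V) using hz.ne'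
  by_cases hxz : ((C.labelGraph i).induce {v}ᶜ).Reachable x z
  · obtain ⟨y, hxy⟩ : ∃ y, ¬ ((C.labelGraph i).induce {v}ᶜ).Reachable x y := by
      by_contra! h
      exact hpq ((h p).symm.trans (h q))
    have hyx := hC.adj_of_not_reachable_induce hi hij hx hxy
    have hyz := hC.adj_of_not_reachable_induce hi hik hz fun h => hxy (hxz.trans h)
    have hzy := hC.adj_of_reachable_induce hxz hxy hyx.symm
    exact hjk (labelGraph_adj_unique hzy.symm hyz)
  · exact hjk (labelGraph_adj_unique (hC.adj_of_not_reachable_induce hi hij hx hxz)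
      (hC.adj_of_not_reachable_induce hi hik hz fun h => hxz h.symm).symm)

theorem IsGallai.subsingleton_of_preconnected [Finite V] (hC : IsGallai C) (hij : i ≠ j)
    (hik : i ≠ k) (hjk : j ≠ k) (hi : (C.labelGraph i).Preconnected)
    (hj : (C.labelGraph j).Preconnected) (hk : (C.labelGraph k).Preconnected) :
    Subsingleton V := by
  induction hn : Nat.card V using Nat.strong_induction_on generalizing V with
  | _ n ih =>
    by_contra! hV
    obtain ⟨v⟩ := hV.to_nonempty
    have hlt : Nat.card ({v}ᶜ : Set V) < n :=
      hn ▸ Finite.card_subtype_lt (x := v) (by simp)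
    have := ih _ hlt (hC.pullback (Function.Embedding.subtype (· ∈ ({v}ᶜ : Set V))))
      (by rw [labelGraph_pullback]
          exact hC.preconnected_induce_compl_singleton hij hik hjk hi hj hk v)
      (by rw [labelGraph_pullback]
          exact hC.preconnected_induce_compl_singleton hij.symm hjk hik hj hi hk v)
      (by rw [labelGraph_pullback]
          exact hC.preconnected_induce_compl_singleton hik.symm hjk.symm hij hk hi hj v) rfl
    obtain ⟨x, hx⟩ := hi.exists_adj_of_nontrivial v
    obtain ⟨y, hy⟩ := hj.exists_adj_of_nontrivial v
    obtain rfl : x = y := congrArg Subtype.val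
      (Subsingleton.elim (⟨x, hx.ne'⟩ : ({v}ᶜ : Set V)) ⟨y, hy.ne'⟩)
    exact hij (labelGraph_adj_unique hx hy)

/-- `C` is a blow-up of the reduced coloring `R` along `f`: the fibers of `f` partition `V`, and all
edges between the fibers over `a ≠ b` have the color of `ab` in `R`. Nothing is required of the
edges inside a fiber. -/
def IsBlowUp (C : TopEdgeLabeling V K) (R : TopEdgeLabeling W K) (f : V → W) : Prop :=
  ∀ ⦃i x y⦄, f x ≠ f y → ((C.labelGraph i).Adj x y ↔ (R.labelGraph i).Adj (f x) (f y))

theorem IsBlowUp.comp {X : Type*} {R : TopEdgeLabeling W K} {Q : TopEdgeLabeling X K} {f : V → W}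
    {g : W → X} (hC : IsBlowUp C R f) (hR : IsBlowUp R Q g) : IsBlowUp C Q (g ∘ f) :=
  fun _ _ _ hne => (hC fun h => hne (congrArg g h)).trans (hR hne)

theorem IsGallai.isBlowUp_connectedComponentMk (hC : IsGallai C) (i : K)
    {r : (C.labelGraph i).ConnectedComponent ↪ V}
    (hr : ∀ c, (C.labelGraph i).connectedComponentMk (r c) = c) :
    IsBlowUp C (C.pullback r) (C.labelGraph i).connectedComponentMk := by
  intro j x y hne
  have hreach (z) : (C.labelGraph i).Reachable z (r ((C.labelGraph i).connectedComponentMk z)) :=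
    ConnectedComponent.exact (hr _).symm
  have hxy : ¬ (C.labelGraph i).Reachable x y := fun h => hne (ConnectedComponent.sound h)
  have transfer {j x y x' y'} (hx : (C.labelGraph i).Reachable x x')
      (hy : (C.labelGraph i).Reachable y y') (hxy : ¬ (C.labelGraph i).Reachable x y)
      (h : (C.labelGraph j).Adj x y) : (C.labelGraph j).Adj x' y' :=
    (hC.adj_of_reachable hy (fun h => hxy (hx.trans h.symm))
      (hC.adj_of_reachable hx hxy h).symm).symm
  rw [labelGraph_pullback, comap_adj]
  exact ⟨transfer (hreach x) (hreach y) hxy,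
    transfer (hreach x).symm (hreach y).symm
      fun h => hxy ((hreach x).trans (h.trans (hreach y).symm))⟩

theorem IsGallai.exists_isBlowUp_forall_eq_bot_or_preconnected {V : Type u} [Finite V]
    [Nontrivial V] {C : TopEdgeLabeling V K} (hC : IsGallai C) :
    ∃ (W : Type u) (_ : Finite W) (_ : Nontrivial W) (R : TopEdgeLabeling W K) (f : V → W),
      f.Surjective ∧ IsGallai R ∧ IsBlowUp C R f ∧
        ∀ i, R.labelGraph i = ⊥ ∨ (R.labelGraph i).Preconnected := by
  induction hn : Nat.card V using Nat.strong_induction_on generalizing V with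
  | _ n ih =>
    by_cases hi : ∀ i, C.labelGraph i = ⊥ ∨ (C.labelGraph i).Preconnected
    · exact ⟨V, ‹_›, ‹_›, C, id, Function.surjective_id, hC, fun _ _ _ _ => .rfl, hi⟩
    push Not at hi
    obtain ⟨i, hbot, hdisc⟩ := hi
    set f := (C.labelGraph i).connectedComponentMk
    have hf : f.Surjective := Quot.mk_surjective
    obtain ⟨x, y, hxy⟩ := ne_bot_iff_exists_adj.1 hbot
    have hlt : Nat.card (C.labelGraph i).ConnectedComponent < n :=
      lt_of_not_ge fun h => hxy.ne ((hf.bijective_of_nat_card_le (hn.trans_le h)).injective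
        (ConnectedComponent.sound hxy.reachable))
    obtain ⟨p, q, hpq⟩ : ∃ p q, ¬ (C.labelGraph i).Reachable p q := by
      simpa only [Preconnected, not_forall] using hdisc
    have : Nontrivial (C.labelGraph i).ConnectedComponent :=
      ⟨f p, f q, fun h => hpq (ConnectedComponent.exact h)⟩
    obtain ⟨W, _, _, R, g, hg, hRG, hR, hall⟩ :=
      ih _ hlt (hC.pullback ⟨_, Function.injective_surjInv hf⟩) rfl
    have hblow := hC.isBlowUp_connectedComponentMk i
      (r := ⟨_, Function.injective_surjInv hf⟩) (Function.surjInv_eq hf)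
    exact ⟨W, ‹_›, ‹_›, R, g ∘ f, hg.comp hf, hRG, hblow.comp hR, hall⟩

theorem IsGallai.exists_isBlowUp {V : Type u} [Finite V] [Nontrivial V]
    {C : TopEdgeLabeling V K} (hC : IsGallai C) :
    ∃ (W : Type u) (_ : Nontrivial W) (R : TopEdgeLabeling W K) (f : V → W) (r b : K),
      f.Surjective ∧ IsBlowUp C R f ∧ (R.labelGraph r).Preconnected ∧
        (R.labelGraph b).Preconnected ∧ ∀ i, i ≠ r → i ≠ b → R.labelGraph i = ⊥ := by
  obtain ⟨W, _, _, R, f, hf, hRG, hR, hall⟩ := hC.exists_isBlowUp_forall_eq_bot_or_preconnected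
  obtain ⟨x, y, hxy⟩ := exists_pair_ne W
  obtain ⟨r, hr⟩ := exists_labelGraph_adj R hxy
  have hrc := (hall r).resolve_left (ne_bot_iff_exists_adj.2 ⟨x, y, hr⟩)
  by_cases hb : ∃ b, b ≠ r ∧ (R.labelGraph b).Preconnected
  · obtain ⟨b, hbr, hbc⟩ := hb
    refine ⟨W, ‹_›, R, f, r, b, hf, hR, hrc, hbc, fun i hir hib => (hall i).resolve_right ?_⟩
    intro hic
    exact not_subsingleton W (hRG.subsingleton_of_preconnected hir hib hbr.symm hic hrc hbc)
  · push Not at hb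
    exact ⟨W, ‹_›, R, f, r, r, hf, hR, hrc, hrc, fun i hir _ => (hall i).resolve_right (hb i hir)⟩

end Structure

section StarPlus

variable {G : SimpleGraph V} {t : ℕ} {ht : 3 ≤ t}

theorem starGraph_le_of_isUniversal {v : V} (h : G.IsUniversal v) : starGraph v ≤ G := by
  intro x y hxy
  rcases starGraph_adj.1 hxy with ⟨hne, rfl | rfl⟩
  · exact h hne
  · exact (h hne.symm).symm

theorem starPlus_isContained {v x y : V} (hvx : G.Adj v x) (hvy : G.Adj v y) (hxy : G.Adj x y)
    (hcard : ((t - 1 : ℕ) : ℕ∞) ≤ (G.neighborSet v).encard) : starPlus t ht ⊑ G := by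
  obtain ⟨n, rfl⟩ : ∃ n, t = 2 + n + 1 := ⟨t - 3, by omega⟩
  let e : Fin 2 ↪ G.neighborSet v :=
    ⟨![⟨x, hvx⟩, ⟨y, hvy⟩], injective_pair_iff_ne.2 (Subtype.coe_ne_coe.1 hxy.ne)⟩
  obtain ⟨g, hg⟩ := Fin.Embedding.restrictSurjective_of_add_le_ENatCard (m := 2) (n := n)
    (by simpa using hcard) e
  let f : Fin (2 + n + 1) → V := Fin.cons v fun a => g a
  have hf : f.Injective := Fin.cons_injective_iff.2
    ⟨fun ⟨a, ha⟩ => (g a).2.ne ha.symm, Subtype.val_injective.comp g.injective⟩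
  have hx : f ⟨1, by omega⟩ = x := congrArg Subtype.val (DFunLike.congr_fun hg 0)
  have hy : f ⟨2, by omega⟩ = y := congrArg Subtype.val (DFunLike.congr_fun hg 1)
  have hstar : (G.comap f).IsUniversal 0 := fun a ha => by
    obtain ⟨b, rfl⟩ := Fin.exists_succ_eq.2 ha.symm
    exact (g b).2
  have hedge : (G.comap f).Adj ⟨1, by omega⟩ ⟨2, by omega⟩ := by rwa [comap_adj, hx, hy]
  have hle : starPlus (2 + n + 1) ht ≤ G.comap f :=
    sup_le (starGraph_le_of_isUniversal hstar) ((edge_le_iff _).2 (.inr hedge))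
  exact isContained_iff_exists_le_comap.2 ⟨⟨f, hf⟩, hle⟩

theorem isIndepSet_of_starPlus_free (hG : (starPlus t ht).Free G) {v : V} {D : Set V}
    (hD : D ⊆ G.neighborSet v) (hcard : t - 1 ≤ D.ncard) : G.IsIndepSet D := fun _ hx _ hy _ hxy =>
  hG (starPlus_isContained (hD hx) (hD hy) hxy
    ((Nat.cast_le.2 hcard).trans ((Set.ncard_le_encard D).trans (Set.encard_le_encard hD))))

theorem ncard_le_of_isClique_of_starPlus_free (hG : (starPlus t ht).Free G) {P : Set V}
    (hP : G.IsClique P) : P.ncard ≤ t - 1 := by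
  by_contra! hcard
  obtain ⟨v, hv⟩ := Set.nonempty_of_ncard_ne_zero (s := P) (by omega)
  have hsub : P \ {v} ⊆ G.neighborSet v := fun x hx => hP hv hx.1 (Ne.symm hx.2)
  have hdiff : (P \ {v}).ncard = P.ncard - 1 := Set.ncard_sdiff_singleton_of_mem hv
  obtain ⟨x, hx, y, hy, hxy⟩ :=
    (Set.one_lt_ncard (Set.finite_of_ncard_pos (by omega))).1 (show 1 < (P \ {v}).ncard by omega)
  exact isIndepSet_of_starPlus_free hG hsub (by omega) hx hy hxy (hP hx.1 hy.1 hxy)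

theorem ncard_neighborSet_le_of_starPlus_free (hG : (starPlus t ht).Free G)
    (hGc : (starPlus t ht).Free Gᶜ) (v : V) : (G.neighborSet v).ncard ≤ t - 1 := by
  by_contra! h
  have hindep := isIndepSet_of_starPlus_free hG subset_rfl h.le
  exact h.not_ge (ncard_le_of_isClique_of_starPlus_free hGc ((isClique_compl G).2 hindep))

theorem card_le_of_starPlus_free_of_starPlus_free_compl [Finite V] (hG : (starPlus t ht).Free G)
    (hGc : (starPlus t ht).Free Gᶜ) : Nat.card V ≤ max (2 * (t - 1)) 5 := by
  by_contra! hlt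
  obtain ⟨v⟩ : Nonempty V := (Nat.card_pos_iff.1 (by omega)).1
  have hle := ncard_neighborSet_le_of_starPlus_free hG hGc
  have hle' := ncard_neighborSet_le_of_starPlus_free hGc (by rwa [compl_compl])
  have hsum (u : V) : Nat.card V - 1 ≤ (G.neighborSet u).ncard + (Gᶜ.neighborSet u).ncard := by
    rw [← Set.ncard_singleton u, ← Set.ncard_compl, ← neighborSet_union_compl_neighborSet_eq]
    exact Set.ncard_union_le _ _
  have hv : (G.neighborSet v).ncard = t - 1 := by grind
  have hv3 : 3 ≤ (G.neighborSet v).ncard := by grind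
  have hclique : Gᶜ.IsClique (G.neighborSet v) :=
    (isClique_compl G).2 (isIndepSet_of_starPlus_free hG subset_rfl hv.ge)
  obtain ⟨u, hu⟩ := Set.nonempty_of_ncard_ne_zero (s := G.neighborSet v) (by omega)
  have hsub : G.neighborSet v \ {u} ⊆ Gᶜ.neighborSet u := fun x hx => hclique hu hx.1 (Ne.symm hx.2)
  have hdiff : (G.neighborSet v \ {u}).ncard = (G.neighborSet v).ncard - 1 :=
    Set.ncard_sdiff_singleton_of_mem hu
  obtain ⟨x, hx, y, hy, hxy⟩ :=
    (Set.one_lt_ncard (Set.toFinite _)).1 (show 1 < (G.neighborSet v \ {u}).ncard by omega)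
  exact isIndepSet_of_starPlus_free hGc subset_rfl (v := u) (by grind) (hsub hx) (hsub hy) hxy
    (hclique hx.1 hy.1 hxy)

theorem ncard_le_of_subset_neighborSet (hG : (starPlus t ht).Free G) {F : ℕ} (hF : t - 1 ≤ F)
    {v : V} {D : Set V} (hD : D ⊆ G.neighborSet v)
    (h : G.IsIndepSet D → D.ncard ≤ F) : D.ncard ≤ F := by
  by_contra! hlt
  exact hlt.not_ge (h (isIndepSet_of_starPlus_free hG hD (by omega)))

end StarPlus

section UpperBound

theorem IsBlowUp.preimage_neighborSet_subset {C : TopEdgeLabeling V K} {R : TopEdgeLabeling W K}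
    {f : V → W} (hR : IsBlowUp C R f) (i : K) (v : V) :
    f ⁻¹' (R.labelGraph i).neighborSet (f v) ⊆ (C.labelGraph i).neighborSet v :=
  fun x (hx : (R.labelGraph i).Adj (f v) (f x)) => (hR hx.ne).2 hx

theorem IsBlowUp.labelGraph_ne_bot [Nontrivial W] {C : TopEdgeLabeling V K}
    {R : TopEdgeLabeling W K} {f : V → W} (hR : IsBlowUp C R f) (hf : f.Surjective) {i : K}
    (hi : (R.labelGraph i).Preconnected) : C.labelGraph i ≠ ⊥ := by
  obtain ⟨v⟩ : Nonempty V := hf.nonempty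
  obtain ⟨a, ha⟩ := hi.exists_adj_of_nontrivial (f v)
  obtain ⟨u, rfl⟩ := hf a
  exact ne_bot_iff_exists_adj.2 ⟨v, u, (hR ha.ne).2 ha⟩

theorem IsBlowUp.fiber_subset_neighborSet {C : TopEdgeLabeling V K} {R : TopEdgeLabeling W K}
    {f : V → W} (hR : IsBlowUp C R f) {i : K} {v : V} {a : W}
    (h : (R.labelGraph i).Adj a (f v)) : f ⁻¹' {a} ⊆ (C.labelGraph i).neighborSet v :=
  (Set.preimage_mono (Set.singleton_subset_iff.2 h.symm)).trans (hR.preimage_neighborSet_subset i v)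

variable {C : TopEdgeLabeling V K} {R : TopEdgeLabeling W K} {f : V → W} {r b : K} {t F : ℕ}
  {ht : 3 ≤ t}

theorem card_le_of_isBlowUp_of_one_color [Finite V] [Nontrivial W]
    (hfree : (starPlus t ht).Free (C.labelGraph r)) (hf : f.Surjective) (hR : IsBlowUp C R f)
    (hr : ∀ i, i ≠ r → R.labelGraph i = ⊥) (hF : t - 1 ≤ F)
    (h : ∀ P, (C.labelGraph r).IsIndepSet P → P.ncard ≤ F) :
    Nat.card V ≤ 2 * F := by
  have adj {a c : W} (hac : a ≠ c) : (R.labelGraph r).Adj a c :=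
    or_self_iff.1 (labelGraph_adj_or_adj (fun i hi _ => hr i hi) hac)
  obtain ⟨a, c, hac⟩ := exists_pair_ne W
  obtain ⟨u, rfl⟩ := hf a
  obtain ⟨v, rfl⟩ := hf c
  have hfiber := ncard_le_of_subset_neighborSet hfree hF (hR.fiber_subset_neighborSet (adj hac))
    (h _)
  have hcompl := ncard_le_of_subset_neighborSet hfree hF (D := (f ⁻¹' {f u})ᶜ) (v := u)
    (fun x hx => hR.preimage_neighborSet_subset r u (adj (Ne.symm hx))) (h _)
  rw [← Set.ncard_add_ncard_compl (f ⁻¹' {f u})]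
  omega

theorem ncard_fiber_le_of_isBlowUp [Nontrivial W]
    (hfree : ∀ i, (starPlus t ht).Free (C.labelGraph i)) (hf : f.Surjective)
    (hR : IsBlowUp C R f) (hr : (R.labelGraph r).Preconnected)
    (hb : (R.labelGraph b).Preconnected) (hF : t - 1 ≤ F)
    (h : ∀ P, (C.labelGraph r).IsIndepSet P → (C.labelGraph b).IsIndepSet P → P.ncard ≤ F)
    (a : W) : (f ⁻¹' {a}).ncard ≤ F := by
  obtain ⟨c, hac⟩ := hr.exists_adj_of_nontrivial a
  obtain ⟨d, had⟩ := hb.exists_adj_of_nontrivial a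
  obtain ⟨u, rfl⟩ := hf c
  obtain ⟨v, rfl⟩ := hf d
  exact ncard_le_of_subset_neighborSet (hfree r) hF (hR.fiber_subset_neighborSet hac) fun hri =>
    ncard_le_of_subset_neighborSet (hfree b) hF (hR.fiber_subset_neighborSet had) (h _ hri)

theorem ncard_preimage_neighborSet_le_of_isBlowUp [Finite V]
    (hfree : ∀ i, (starPlus t ht).Free (C.labelGraph i)) (hf : f.Surjective) (hR : IsBlowUp C R f)
    (hrb : ∀ i, i ≠ r → i ≠ b → R.labelGraph i = ⊥) (hF : t - 1 ≤ F)
    (h : ∀ P, (C.labelGraph r).IsIndepSet P → (C.labelGraph b).IsIndepSet P → P.ncard ≤ F)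
    (hfiber : ∀ a, (f ⁻¹' {a}).ncard ≤ F) (a : W) :
    (f ⁻¹' (R.labelGraph r).neighborSet a).ncard ≤ 2 * F := by
  obtain ⟨v, rfl⟩ := hf a
  set D := f ⁻¹' (R.labelGraph r).neighborSet (f v)
  have hD : D ⊆ (C.labelGraph r).neighborSet v := hR.preimage_neighborSet_subset r v
  refine ncard_le_of_subset_neighborSet (hfree r) (by omega) hD fun hindep => ?_
  obtain hempty | ⟨x, hx⟩ := D.eq_empty_or_nonempty
  · simp [hempty]
  have hdiff : D \ f ⁻¹' {f x} ⊆ (C.labelGraph b).neighborSet x := by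
    rintro y ⟨hy, hyx⟩
    have hxy : f x ≠ f y := Ne.symm hyx
    rw [mem_neighborSet, hR hxy]
    refine (labelGraph_adj_or_adj hrb hxy).resolve_left fun h => ?_
    exact hindep hx hy (fun h => hxy (congrArg f h)) ((hR hxy).2 h)
  have hrest : (D \ f ⁻¹' {f x}).ncard ≤ F :=
    ncard_le_of_subset_neighborSet (hfree b) hF hdiff
      (h _ (hindep.mono Set.sdiff_subset))
  have := Set.ncard_le_ncard_sdiff_add_ncard D (f ⁻¹' {f x})
  have := hfiber (f x)
  omega

theorem card_le_of_isBlowUp_of_two_colors [Finite V] [Nontrivial W]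
    (hfree : ∀ i, (starPlus t ht).Free (C.labelGraph i)) (hf : f.Surjective)
    (hR : IsBlowUp C R f) (hr : (R.labelGraph r).Preconnected)
    (hb : (R.labelGraph b).Preconnected) (hrb : ∀ i, i ≠ r → i ≠ b → R.labelGraph i = ⊥)
    (hF : t - 1 ≤ F)
    (h : ∀ P, (C.labelGraph r).IsIndepSet P → (C.labelGraph b).IsIndepSet P → P.ncard ≤ F) :
    Nat.card V ≤ 5 * F := by
  have hfiber := ncard_fiber_le_of_isBlowUp hfree hf hR hr hb hF h
  obtain ⟨a⟩ : Nonempty W := inferInstance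
  have hDr := ncard_preimage_neighborSet_le_of_isBlowUp hfree hf hR hrb hF h hfiber a
  have hDb := ncard_preimage_neighborSet_le_of_isBlowUp hfree hf hR (fun i hib hir => hrb i hir hib)
    hF (fun P hbi hri => h P hri hbi) hfiber a
  have hcover : Set.univ ⊆ f ⁻¹' {a} ∪ (f ⁻¹' (R.labelGraph r).neighborSet a ∪
      f ⁻¹' (R.labelGraph b).neighborSet a) := by
    intro x _
    by_cases hx : f x = a
    · exact .inl hx
    · exact .inr (labelGraph_adj_or_adj hrb (Ne.symm hx))
  have hle := (Set.ncard_le_ncard hcover).trans (Set.ncard_union_le _ _)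
  have := Set.ncard_union_le (f ⁻¹' (R.labelGraph r).neighborSet a)
    (f ⁻¹' (R.labelGraph b).neighborSet a)
  have := hfiber a
  rw [Set.ncard_univ] at hle
  omega

/-- The largest order of a Gallai coloring with `k` colors without a monochromatic `starPlus` on
`N + 1` vertices. In the recursion, `2` and `5` are the orders of the one- and two-colored complete
graphs into which the extremal colorings with fewer colors are substituted. -/
def extremalOrder (N : ℕ) : ℕ → ℕ
  | 0 => 1
  | 1 => N
  | k + 2 => max (2 * extremalOrder N (k + 1)) (5 * extremalOrder N k)

theorem le_extremalOrder_succ (N k : ℕ) : N ≤ extremalOrder N (k + 1) := by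
  induction k with
  | zero => rfl
  | succ k ih => grind [extremalOrder]

theorem extremalOrder_pos {N : ℕ} (hN : 0 < N) : ∀ k, 0 < extremalOrder N k
  | 0 => one_pos
  | k + 1 => hN.trans_le (le_extremalOrder_succ N k)

theorem IsGallai.card_le_max [Finite V] [Nontrivial V] (hC : IsGallai C)
    (hfree : ∀ i, (starPlus t ht).Free (C.labelGraph i)) {F₁ F₂ : ℕ} (hF₁ : t - 1 ≤ F₁)
    (hF₂ : t - 1 ≤ F₂)
    (h₁ : ∀ i P, C.labelGraph i ≠ ⊥ → (C.labelGraph i).IsIndepSet P → P.ncard ≤ F₁)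
    (h₂ : ∀ i j P, i ≠ j → C.labelGraph i ≠ ⊥ → C.labelGraph j ≠ ⊥ →
      (C.labelGraph i).IsIndepSet P → (C.labelGraph j).IsIndepSet P → P.ncard ≤ F₂) :
    Nat.card V ≤ max (2 * F₁) (5 * F₂) := by
  obtain ⟨W, _, R, f, r, b, hf, hR, hr, hb, hrb⟩ := hC.exists_isBlowUp
  have hrne := hR.labelGraph_ne_bot hf hr
  have hbne := hR.labelGraph_ne_bot hf hb
  by_cases hne : r = b
  · subst hne
    exact le_max_of_le_left (card_le_of_isBlowUp_of_one_color (hfree r) hf hR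
      (fun i hi => hrb i hi hi) hF₁ fun P => h₁ r P hrne)
  · exact le_max_of_le_right (card_le_of_isBlowUp_of_two_colors hfree hf hR hr hb hrb hF₂
      fun P => h₂ r b P hne hrne hbne)

theorem card_le_extremalOrder_of_ncard_le_two [Finite V]
    (hfree : ∀ i, (starPlus t ht).Free (C.labelGraph i)) {S : Set K} (hS : S.Finite)
    (hbot : ∀ i, i ∉ S → C.labelGraph i = ⊥) (hcard : S.ncard ≤ 2) :
    Nat.card V ≤ extremalOrder (t - 1) S.ncard := by
  cases subsingleton_or_nontrivial V
  · exact (Finite.card_le_one_iff_subsingleton.2 ‹_›).trans (extremalOrder_pos (by omega) _)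
  obtain h | h | h : S.ncard = 0 ∨ S.ncard = 1 ∨ S.ncard = 2 := by omega
  · obtain ⟨x, y, hxy⟩ := exists_pair_ne V
    obtain ⟨i, hi⟩ := exists_labelGraph_adj C hxy
    rw [(Set.ncard_eq_zero hS).1 h] at hbot
    simp [hbot i (Set.notMem_empty i)] at hi
  · obtain ⟨i, rfl⟩ := Set.ncard_eq_one.1 h
    have hclique : (C.labelGraph i).IsClique Set.univ := fun x _ y _ hxy =>
      or_self_iff.1 (labelGraph_adj_or_adj (fun j hj _ => hbot j hj) hxy)
    rw [h, ← Set.ncard_univ]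
    exact ncard_le_of_isClique_of_starPlus_free (hfree i) hclique
  · obtain ⟨i, j, hij, rfl⟩ := Set.ncard_eq_two.1 h
    have hcompl : C.labelGraph j = (C.labelGraph i)ᶜ :=
      labelGraph_eq_compl hij fun k hki hkj => hbot k (by simp [hki, hkj])
    rw [h]
    exact card_le_of_starPlus_free_of_starPlus_free_compl (hfree i) (hcompl ▸ hfree j)

theorem IsGallai.card_le_extremalOrder {V : Type u} [Finite V] {C : TopEdgeLabeling V K}
    (hC : IsGallai C) (hfree : ∀ i, (starPlus t ht).Free (C.labelGraph i)) {S : Set K}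
    (hS : S.Finite) (hbot : ∀ i, i ∉ S → C.labelGraph i = ⊥) :
    Nat.card V ≤ extremalOrder (t - 1) S.ncard := by
  induction hn : S.ncard using Nat.strong_induction_on generalizing V S with
  | _ n ih =>
  cases subsingleton_or_nontrivial V
  · exact (Finite.card_le_one_iff_subsingleton.2 ‹_›).trans (extremalOrder_pos (by omega) n)
  obtain hle | ⟨m, rfl⟩ : n ≤ 2 ∨ ∃ m, n = m + 3 :=
    (le_or_gt n 2).imp_right Nat.exists_eq_add_of_le'
  · exact hn ▸ card_le_extremalOrder_of_ncard_le_two hfree hS hbot (hn.trans_le hle)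
  have restrict {l : ℕ} (hl : l < m + 3) {P : Set V} {T : Set K} (hT : T ⊆ S)
      (hcard : l + T.ncard = m + 3) (hP : ∀ i ∈ T, (C.labelGraph i).IsIndepSet P) :
      P.ncard ≤ extremalOrder (t - 1) l := by
    have hdiff : (S \ T).ncard = l := by rw [Set.ncard_sdiff hT (hS.subset hT)]; omega
    refine ih l hl (hC.pullback (Function.Embedding.subtype (· ∈ P)))
      (fun i => free_labelGraph_pullback (hfree i) _) hS.sdiff (fun i hi => ?_) hdiff
    by_cases hiT : i ∈ T
    · exact labelGraph_pullback_subtype_eq_bot_iff.2 (hP i hiT)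
    · rw [labelGraph_pullback, hbot i fun hiS => hi ⟨hiS, hiT⟩, comap_bot]
  have mem {i : K} (hi : C.labelGraph i ≠ ⊥) : i ∈ S := not_not.1 (mt (hbot i) hi)
  refine hC.card_le_max hfree (le_extremalOrder_succ _ (m + 1)) (le_extremalOrder_succ _ m) ?_ ?_
  · intro i P hi hP
    exact restrict (by omega) (Set.singleton_subset_iff.2 (mem hi)) (by simp) (by simpa using hP)
  · intro i j P hij hi hj hPi hPj
    exact restrict (by omega) (Set.pair_subset (mem hi) (mem hj)) (by rw [Set.ncard_pair hij])
      (by simp [hPi, hPj])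

end UpperBound

section LowerBound

variable {H : SimpleGraph U}

theorem cliqueFree_of_hom {n : ℕ} {G : SimpleGraph V} (f : H →g G) (hG : G.CliqueFree n) :
    H.CliqueFree n := by
  contrapose! hG
  rw [not_cliqueFree_iff_top_isContained] at hG ⊢
  obtain ⟨g⟩ := hG
  exact ⟨⟨f.comp g.toHom, Hom.injective_of_top_hom _⟩⟩

theorem free_of_preconnected_of_free_bot_boxProd {G : SimpleGraph V} (hH : H.Preconnected)
    (hG : H.Free G) : H.Free ((⊥ : SimpleGraph W) □ G) := by
  rintro ⟨f⟩
  have adj {x y : U} (hxy : H.Adj x y) : G.Adj (f x).2 (f y).2 ∧ (f x).1 = (f y).1 := by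
    have h : ((⊥ : SimpleGraph W) □ G).Adj (f x) (f y) := f.toHom.map_adj hxy
    simpa only [boxProd_adj, bot_adj, false_and, false_or] using h
  have fst_eq (x y : U) : (f x).1 = (f y).1 := by
    obtain ⟨p⟩ := hH x y
    induction p with
    | nil => rfl
    | cons hxy _ ih => exact (adj hxy).2.trans ih
  exact hG ⟨⟨fun x => (f x).2, fun hxy => (adj hxy).1⟩,
    fun x y hxy => f.injective (Prod.ext (fst_eq x y) hxy)⟩

open scoped Classical in
/-- Substitution of a copy of the coloring `C` for every vertex of the coloring `R`, the two
colorings using disjoint sets of colors. -/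
noncomputable def substitute (R : TopEdgeLabeling W L) (C : TopEdgeLabeling V K) :
    TopEdgeLabeling (W × V) (L ⊕ K) :=
  EdgeLabeling.mk
    (fun p q hpq => if h : p.1 = q.1 then .inr (C.get p.2 q.2 fun h' => hpq (Prod.ext h h'))
      else .inl (R.get p.1 q.1 h))
    fun p q hpq => by
      by_cases h : p.1 = q.1
      · simp only [h, dite_true, EdgeLabeling.get_comm p.2]
      · simp only [h, Ne.symm h, dite_false, EdgeLabeling.get_comm p.1]

theorem labelGraph_substitute_inl (R : TopEdgeLabeling W L) (C : TopEdgeLabeling V K) (i : L) :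
    (substitute R C).labelGraph (.inl i) = (R.labelGraph i).comap Prod.fst := by
  ext p q
  simp only [TopEdgeLabeling.labelGraph_adj, substitute, EdgeLabeling.get_mk, comap_adj]
  by_cases h : p.1 = q.1 <;> simp [h, Prod.ext_iff]

theorem labelGraph_substitute_inr (R : TopEdgeLabeling W L) (C : TopEdgeLabeling V K) (i : K) :
    (substitute R C).labelGraph (.inr i) = ⊥ □ C.labelGraph i := by
  ext p q
  simp only [TopEdgeLabeling.labelGraph_adj, substitute, EdgeLabeling.get_mk, boxProd_adj, bot_adj]
  by_cases h : p.1 = q.1 <;> simp [h, Prod.ext_iff]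

theorem IsGallai.substitute {R : TopEdgeLabeling W L} {C : TopEdgeLabeling V K} (hR : IsGallai R)
    (hC : IsGallai C) : IsGallai (substitute R C) := by
  intro p q r i j k hpq hqr hpr
  rcases i with i | i <;> rcases j with j | j <;> rcases k with k | k <;>
    simp only [labelGraph_substitute_inl, labelGraph_substitute_inr, comap_adj, boxProd_adj,
      bot_adj, false_and, false_or, Sum.inl.injEq, Sum.inr.injEq, reduceCtorEq, or_false]
      at hpq hqr hpr ⊢
  · exact hR hpq hqr hpr
  · rw [hpr.2] at hpq
    exact labelGraph_adj_unique hpq hqr.symm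
  · rw [hqr.2] at hpq
    exact labelGraph_adj_unique hpq hpr
  · exact absurd (hpr.2.trans hqr.2.symm) hpq.ne
  · rw [hpq.2] at hpr
    exact labelGraph_adj_unique hqr hpr
  · exact absurd (hpq.2.symm.trans hpr.2) hqr.ne
  · exact absurd (hpq.2.trans hqr.2) hpr.ne
  · exact hC hpq.1 hqr.1 hpr.1

/-- The existence of a Gallai coloring of the complete graph on `n` vertices with `k` colors and
without a monochromatic copy of `H`. -/
def HasGallaiLabeling (H : SimpleGraph U) (k n : ℕ) : Prop :=
  ∃ C : TopEdgeLabeling (Fin n) (Fin k), IsGallai C ∧ ∀ i, H.Free (C.labelGraph i)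

theorem HasGallaiLabeling.of_labeling [Finite V] [Finite K] {C : TopEdgeLabeling V K} {k n : ℕ}
    (hC : IsGallai C) (hfree : ∀ i, H.Free (C.labelGraph i)) (hk : Nat.card K = k)
    (hn : n ≤ Nat.card V) : HasGallaiLabeling H k n := by
  let e : K ≃ Fin k := Finite.equivFinOfCardEq hk
  obtain ⟨f⟩ : Nonempty (Fin n ↪ V) :=
    ⟨(Fin.castLEEmb hn).trans (Finite.equivFin V).symm.toEmbedding⟩
  have hlabel (i : Fin k) : EdgeLabeling.labelGraph ((C.pullback f).compRight e) i =
    (C.pullback f).labelGraph (e.symm i) := labelGraph_compRight _ e i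
  refine ⟨(C.pullback f).compRight e, fun x y z i j k hxy hyz hxz => ?_, fun i => ?_⟩
  · rw [hlabel] at hxy hyz hxz
    simpa only [e.symm.injective.eq_iff] using hC.pullback f hxy hyz hxz
  · rw [hlabel]
    exact free_labelGraph_pullback (hfree _) f

theorem HasGallaiLabeling.mono {k m n : ℕ} (h : HasGallaiLabeling H k n) (hmn : m ≤ n) :
    HasGallaiLabeling H k m :=
  let ⟨_, hC, hfree⟩ := h
  .of_labeling hC hfree (Nat.card_fin k) (hmn.trans_eq (Nat.card_fin n).symm)

theorem isGallaiRamseyNumber_of_hasGallaiLabeling {k n : ℕ} (h : HasGallaiLabeling H k n)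
    (hmax : ∀ m, HasGallaiLabeling H k m → m ≤ n) :
    IsGallaiRamseyNumber k (⊤ : SimpleGraph (Fin 3)) H (n + 1) := by
  have mem_iff (m : ℕ) : (∀ C : TopEdgeLabeling (Fin m) (Fin k),
      HasRainbowCopy C (⊤ : SimpleGraph (Fin 3)) ∨ HasMonochromaticCopy C H) ↔
        ¬ HasGallaiLabeling H k m := by
    simp [HasGallaiLabeling, hasRainbowCopy_triangle_iff, HasMonochromaticCopy, imp_iff_not_or]
  refine ⟨(mem_iff _).2 fun h => absurd (hmax _ h) (by omega), fun m hm => ?_⟩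
  by_contra! hlt
  exact (mem_iff m).1 hm (h.mono (by omega))

theorem HasGallaiLabeling.substitute [Finite W] [Finite L] {R : TopEdgeLabeling W L}
    {k l m n c : ℕ} (hR : IsGallai R) (hRc : ∀ i, (R.labelGraph i).CliqueFree c)
    (hH : H.Preconnected) (hHc : ¬ H.CliqueFree c) (hl : Nat.card L = l) (hm : Nat.card W = m)
    (h : HasGallaiLabeling H k n) : HasGallaiLabeling H (k + l) (m * n) := by
  obtain ⟨C, hC, hfree⟩ := h
  refine .of_labeling (hR.substitute hC) (fun i => ?_) (by simp [hl, add_comm]) (by simp [hm])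
  rcases i with i | i
  · rw [labelGraph_substitute_inl]
    rintro ⟨f⟩
    exact hHc (cliqueFree_of_hom ((Hom.comap Prod.fst _).comp f.toHom) (hRc i))
  · rw [labelGraph_substitute_inr]
    exact free_of_preconnected_of_free_bot_boxProd hH (hfree i)

theorem hasGallaiLabeling_zero_one (H : SimpleGraph U) : HasGallaiLabeling H 0 1 := by
  let C : TopEdgeLabeling (Fin 1) (Fin 0) :=
    EdgeLabeling.mk (fun x y hxy => absurd (Subsingleton.elim x y) hxy)
      fun x y hxy => absurd (Subsingleton.elim x y) hxy
  exact ⟨C, isGallai_of_card_le_two (by simp) C, fun i => i.elim0⟩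

theorem hasGallaiLabeling_one [Fintype U] (H : SimpleGraph U) {n : ℕ} (hn : n < Fintype.card U) :
    HasGallaiLabeling H 1 n := by
  refine ⟨fun _ => 0, isGallai_of_card_le_two (by simp) _, fun i ⟨f⟩ => hn.not_ge ?_⟩
  simpa using Fintype.card_le_of_injective f f.injective

theorem HasGallaiLabeling.two_mul {k n : ℕ} (hH : H.Preconnected) (hH3 : ¬ H.CliqueFree 3)
    (h : HasGallaiLabeling H k n) : HasGallaiLabeling H (k + 1) (2 * n) :=
  .substitute (R := fun _ => (0 : Fin 1)) (W := Fin 2) (isGallai_of_card_le_two (by simp) _)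
    (fun _ => cliqueFree_of_card_lt (by simp)) hH hH3 (Nat.card_fin 1) (Nat.card_fin 2) h

theorem cliqueFree_three_iff {G : SimpleGraph V} :
    G.CliqueFree 3 ↔ ∀ a b c, ¬ (G.Adj a b ∧ G.Adj a c ∧ G.Adj b c) := by
  classical
  refine ⟨fun h a b c habc => h {a, b, c} (is3Clique_triple_iff.2 habc), fun h s hs => ?_⟩
  obtain ⟨a, b, c, hab, hac, hbc, -⟩ := is3Clique_iff.1 hs
  exact h a b c ⟨hab, hac, hbc⟩

theorem cycleGraph_five_cliqueFree_three : (cycleGraph 5).CliqueFree 3 :=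
  cliqueFree_three_iff.2 (by decide)

theorem cycleGraph_five_compl_cliqueFree_three : (cycleGraph 5)ᶜ.CliqueFree 3 :=
  cliqueFree_three_iff.2 (by decide)

theorem HasGallaiLabeling.five_mul {k n : ℕ} (hH : H.Preconnected) (hH3 : ¬ H.CliqueFree 3)
    (h : HasGallaiLabeling H k n) : HasGallaiLabeling H (k + 2) (5 * n) := by
  refine .substitute (R := (cycleGraph 5).toTopEdgeLabeling) (isGallai_of_card_le_two (by simp) _)
    (fun i => ?_) hH hH3 (Nat.card_fin 2) (Nat.card_fin 5) h
  fin_cases i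
  · simpa using cycleGraph_five_compl_cliqueFree_three
  · simpa using cycleGraph_five_cliqueFree_three

theorem hasGallaiLabeling_extremalOrder [Fintype U] {N : ℕ} (hN : N < Fintype.card U)
    (hH : H.Preconnected) (hH3 : ¬ H.CliqueFree 3) :
    ∀ k, HasGallaiLabeling H k (extremalOrder N k)
  | 0 => hasGallaiLabeling_zero_one H
  | 1 => hasGallaiLabeling_one H hN
  | k + 2 => by
    rw [extremalOrder]
    rcases max_choice (2 * extremalOrder N (k + 1)) (5 * extremalOrder N k) with h | h <;> rw [h]
    · exact (hasGallaiLabeling_extremalOrder hN hH hH3 (k + 1)).two_mul hH hH3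
    · exact (hasGallaiLabeling_extremalOrder hN hH hH3 k).five_mul hH hH3

theorem starPlus_preconnected {t : ℕ} (ht : 3 ≤ t) : (starPlus t ht).Preconnected :=
  (connected_starGraph _).preconnected.mono le_sup_left

theorem starPlus_not_cliqueFree_three {t : ℕ} (ht : 3 ≤ t) : ¬ (starPlus t ht).CliqueFree 3 :=
  fun h => cliqueFree_three_iff.1 h ⟨0, by omega⟩ ⟨1, by omega⟩ ⟨2, by omega⟩
    (by simp [starPlus, edge_adj])

end LowerBound

theorem isGallaiRamseyNumber_starPlus (k : ℕ) {t : ℕ} (ht : 3 ≤ t) :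
    IsGallaiRamseyNumber k (⊤ : SimpleGraph (Fin 3)) (starPlus t ht)
      (extremalOrder (t - 1) k + 1) := by
  refine isGallaiRamseyNumber_of_hasGallaiLabeling (hasGallaiLabeling_extremalOrder (by simp; omega)
    (starPlus_preconnected ht) (starPlus_not_cliqueFree_three ht) k) ?_
  rintro m ⟨C, hC, hfree⟩
  simpa using hC.card_le_extremalOrder hfree Set.finite_univ fun i hi => absurd (Set.mem_univ i) hi

theorem extremalOrder_eq {N : ℕ} (hN : 2 ≤ N) (j : ℕ) :
    extremalOrder N (2 * j + 1) = N * 5 ^ j ∧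
      extremalOrder N (2 * j + 2) = max (2 * N) 5 * 5 ^ j := by
  induction j with
  | zero => simp [extremalOrder]
  | succ j ih =>
    have hodd : extremalOrder N (2 * (j + 1) + 1) = N * 5 ^ (j + 1) := calc
      _ = max (2 * (max (2 * N) 5 * 5 ^ j)) (5 * (N * 5 ^ j)) := by
        rw [← ih.1, ← ih.2]; rfl
      _ = max (2 * max (2 * N) 5) (5 * N) * 5 ^ j := by
        rw [← mul_assoc, ← mul_assoc, Nat.mul_max_mul_right]
      _ = N * 5 ^ (j + 1) := by rw [max_eq_right (by omega)]; ring
    refine ⟨hodd, ?_⟩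
    calc
      _ = max (2 * (N * 5 ^ (j + 1))) (5 * (max (2 * N) 5 * 5 ^ j)) := by
        rw [← hodd, ← ih.2]; rfl
      _ = max (2 * N) (max (2 * N) 5) * 5 ^ (j + 1) := by
        rw [← Nat.mul_max_mul_right (2 * N) (max (2 * N) 5)]; congr 1 <;> ring
      _ = max (2 * N) 5 * 5 ^ (j + 1) := by rw [max_eq_right (le_max_left _ _)]

end GallaiRamsey

open GallaiRamsey in
theorem theorem3p3_general (k t : ℕ) (hk : 1 ≤ k) (ht : 3 ≤ t) :
    (Even k → IsGallaiRamseyNumber k (⊤ : SimpleGraph (Fin 3)) (starPlus t ht)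
      (max (2 * (t - 1)) 5 * 5 ^ ((k - 2) / 2) + 1)) ∧
    (Odd k → IsGallaiRamseyNumber k (⊤ : SimpleGraph (Fin 3)) (starPlus t ht)
      ((t - 1) * 5 ^ ((k - 1) / 2) + 1)) := by
  have h := isGallaiRamseyNumber_starPlus k ht
  have horder (j : ℕ) := extremalOrder_eq (N := t - 1) (by omega) j
  constructor <;> intro hparity
  · rwa [← (horder _).2, show 2 * ((k - 2) / 2) + 2 = k by grind]
  · rwa [← (horder _).1, show 2 * ((k - 1) / 2) + 1 = k by grind]

theorem theorem3p3 (k t : ℕ) (hk : 1 ≤ k) (ht : 3 ≤ t) (h3 : t = 3 → Odd k) :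
    (Even k → GallaiRamsey.IsGallaiRamseyNumber k (⊤ : SimpleGraph (Fin 3))
      (GallaiRamsey.starPlus t ht) (2 * (t - 1) * 5 ^ ((k - 2) / 2) + 1)) ∧
    (Odd k → GallaiRamsey.IsGallaiRamseyNumber k (⊤ : SimpleGraph (Fin 3))
      (GallaiRamsey.starPlus t ht) ((t - 1) * 5 ^ ((k - 1) / 2) + 1)) := by
  refine ⟨fun heven => ?_, (theorem3p3_general k t hk ht).2⟩
  have ht3 : t ≠ 3 := fun h => Nat.not_odd_iff_even.2 heven (h3 h)
  simpa only [max_eq_left (show 5 ≤ 2 * (t - 1) by omega)] using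
    (theorem3p3_general k t hk ht).1 heven
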